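/- Let $p\geq 5$ be a prime. For $1\leq a\leq p-1$ let $q_a=\frac{a^{p-1}-1}{p}$ be the Fermat quotient in base $a$, and let $w_p=\frac{(p-1)!+1}{p}$ be the Wilson quotient. Let $B_t$ denote the $t$-th Bernoulli number, and let $\mathfrak{B}_t=B_t/t$ for $t\geq 1$. Set $T\mathcal{C}\mathfrak{B}(4,p-3)=\sum_{k=4}^{p-3}\mathfrak{B}_k\,\mathfrak{B}_{p+1-k}$ (an empty sum, equal to $0$, when $p=5$). For a $p$-adic integer $x$ let $(x)_i\in\{0,\dots,p-1\}$ denote its digits in the expansion $x=\sum_{i\geq 0}(x)_i\,p^i$. Congruences modulo $p$ are understood modulo $p\mathbb{Z}_p$. Then $\mathfrak{B}_{p+1}-\mathfrak{B}_2=\frac{B_{p+1}}{p+1}-\frac{B_2}{2}$ is a $p$-adic integer, and $$\sum_{a=1}^{p-1}q_a^2a^2\equiv\frac{1}{6}w_p-\frac14-T\mathcal{C}\mathfrak{B}(4,p-3)\pmod p,$$ $$\sum_{a=1}^{p-1}q_a^2a^2\equiv-2\left(\mathfrak{B}_{p+1}-\mathfrak{B}_2\right)_1-\frac12\pmod p,$$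 $$\sum_{a=1}^{p-1}q_a^2a^2\equiv\frac{6pB_{2p}-12pB_{p+1}+p(p-1)(2p-1)}{6p^2}\pmod p.$$ -/

import Mathlib

/-- The Fermat quotient `q_a = (a ^ (p - 1) - 1) / p` in base `a`, as a rational number
(it is an integer when `p` is a prime not dividing `a`). -/
def fermatQuot (p a : ℕ) : ℚ := ((a : ℚ) ^ (p - 1) - 1) / p

/-- The Wilson quotient `w_p = ((p - 1)! + 1) / p`, as a rational number
(it is an integer when `p` is prime). -/
def wilsonQuot (p : ℕ) : ℚ := ((Nat.factorial (p - 1) : ℚ) + 1) / p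

/-- The divided Bernoulli number `B_t / t`, used for `t ≥ 1`. -/
def dividedBernoulli (t : ℕ) : ℚ := bernoulli t / t

/-- The truncated convolution of divided Bernoulli numbers whose indices run
from `m` to `n` and add up to `m + n`. For `m = p + 1 - 2 k` and `n = p - 3`, the indices
add up to `2 (p - 1) - 2 k`. -/
def truncConv (m n : ℕ) : ℚ :=
  ∑ k ∈ Finset.Icc m n, dividedBernoulli k * dividedBernoulli (m + n - k)

/-- Congruence of two rational numbers modulo `p ℤ_p`: their difference is `p` times a
`p`-adic integer. -/
def CongrMod (p : ℕ) [Fact p.Prime] (x y : ℚ) : Prop :=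
  ∃ z : ℤ_[p], ((x - y : ℚ) : ℚ_[p]) = (p : ℚ_[p]) * (z : ℚ_[p])

/-- The digit `(x)_i ∈ {0, …, p - 1}` in the Hensel expansion `x = ∑ i, (x)_i p ^ i` of a
`p`-adic integer: `x.appr (i + 1)` is the representative of `x` modulo `p ^ (i + 1)` in
`{0, …, p ^ (i + 1) - 1}`, and its leading base-`p` digit is taken. -/
noncomputable def henselDigit {p : ℕ} [Fact p.Prime] (x : ℤ_[p]) (i : ℕ) : ℕ :=
  x.appr (i + 1) / p ^ i

/-! Write S_n for `powSum p n` and F_n for `fermatSum p n`. Since p q_a = a^(p-1) - 1, squaring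
gives exactly p^2 Σ q_a^2 a^2 = S_{2p} - 2 S_{p+1} + S_2, and S_2 has a closed form. So the last two
congruences only need S_{2p} and S_{p+1} modulo p^3. Faulhaber's formula gives S_n ≡ p B_n there
(`powSum_sub_mul_bernoulli_cube_mem`), hence the third congruence. For the second, Voronoi's device
of permuting residues by a ↦ g a gives S_{2p} ≡ p S_2 (`powSum_two_mul`), so that only B_{p+1}
survives.

The first congruence is Parseval modulo p: Σ F_n F_{p+1-n} over 1 ≤ n ≤ p-1 is -Σ q_a^2 a^2
(`dvd_sum_fermatSum_mul`). Here F_n ≡ -B_n/n for 2 ≤ n ≤ p-2 by Kummer, F_1 ≡ F_p ≡ 1/2, and F_{p-1}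
≡ w_p by Lerch. The outer terms give 1/4 - w_p/6, the others the convolution. -/

/-- The power sum `1 ^ n + 2 ^ n + ⋯ + (p - 1) ^ n`. -/
def powSum (p n : ℕ) : ℤ := ∑ a ∈ Finset.Icc 1 (p - 1), (a : ℤ) ^ n

/-- The sum of `(g a mod p) ^ m * ⌊g a / p⌋` over `1 ≤ a ≤ p - 1`. -/
def floorSum (p g m : ℕ) : ℤ :=
  ∑ a ∈ Finset.Icc 1 (p - 1), ((g * a % p : ℕ) : ℤ) ^ m * ((g * a / p : ℕ) : ℤ)

/-- The Fermat quotient as an integer. -/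
def fermatInt (p a : ℕ) : ℤ := ((a : ℤ) ^ (p - 1) - 1) / p

/-- The power sum weighted by Fermat quotients. -/
def fermatSum (p n : ℕ) : ℤ := ∑ a ∈ Finset.Icc 1 (p - 1), fermatInt p a * (a : ℤ) ^ n

lemma exists_add_pow_cubic (x y : ℤ) (n : ℕ) :
    ∃ k : ℤ, (x + y) ^ (n + 2) =
      x ^ (n + 2) + (n + 2) * x ^ (n + 1) * y + ((n + 2).choose 2 : ℕ) * x ^ n * y ^ 2
        + k * y ^ 3 := by
  induction n with
  | zero => exact ⟨0, by norm_num [Nat.choose]; ring⟩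
  | succ n ih =>
    obtain ⟨k, hk⟩ := ih
    refine ⟨(x + y) * k + ((n + 2).choose 2 : ℕ) * x ^ n, ?_⟩
    have h : (n + 1 + 2).choose 2 = (n + 2) + (n + 2).choose 2 := by
      rw [Nat.choose_succ_succ' (n + 2) 1, Nat.choose_one_right]
    rw [show n + 1 + 2 = (n + 2) + 1 from rfl, pow_succ, hk, h]
    push_cast
    ring

/-! ### Voronoi congruences for power sums -/

section
variable {p : ℕ} [hpf : Fact p.Prime]

lemma coprime_of_mem_Icc {a : ℕ} (ha : a ∈ Finset.Icc 1 (p - 1)) : a.Coprime p := by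
  have hp := hpf.out.two_le
  rw [Finset.mem_Icc] at ha
  exact Nat.Coprime.symm ((Nat.Prime.coprime_iff_not_dvd hpf.out).2
    fun h => by have := Nat.le_of_dvd (by omega) h; omega)

lemma int_dvd_pow_sub_one {a : ℕ} (ha : a.Coprime p) : (p : ℤ) ∣ (a : ℤ) ^ (p - 1) - 1 := by
  have h := Int.ModEq.pow_card_sub_one_eq_one hpf.out (n := a)
    (Nat.isCoprime_iff_coprime.2 ha)
  exact h.symm.dvd

lemma pow_eq_one_add_fermatInt {a : ℕ} (ha : a ∈ Finset.Icc 1 (p - 1)) :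
    (a : ℤ) ^ (p - 1) = 1 + p * fermatInt p a := by
  rw [fermatInt, Int.mul_ediv_cancel' (int_dvd_pow_sub_one (coprime_of_mem_Icc ha))]
  ring

lemma sum_mul_mod {M : Type*} [AddCommMonoid M] {g : ℕ} (hg : g.Coprime p) (f : ℕ → M) :
    ∑ a ∈ Finset.Icc 1 (p - 1), f (g * a % p) = ∑ a ∈ Finset.Icc 1 (p - 1), f a := by
  have hp := hpf.out.two_le
  have hmaps : Set.MapsTo (fun a => g * a % p) (Finset.Icc 1 (p - 1) : Finset ℕ)
      (Finset.Icc 1 (p - 1) : Finset ℕ) := by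
    intro a ha
    have hc := coprime_of_mem_Icc (p := p) ha
    have h1 : g * a % p ≠ 0 := fun h =>
      (Nat.Prime.coprime_iff_not_dvd hpf.out).1 (Nat.Coprime.mul_left hg hc).symm
        (Nat.dvd_of_mod_eq_zero h)
    have h2 := Nat.mod_lt (g * a) (show p > 0 by omega)
    simp only [Finset.coe_Icc, Set.mem_Icc]
    omega
  have hinj : Set.InjOn (fun a => g * a % p) (Finset.Icc 1 (p - 1) : Finset ℕ) := by
    intro a ha b hb hab
    simp only [Finset.coe_Icc, Set.mem_Icc] at ha hb
    have h : a ≡ b [MOD p] := Nat.ModEq.cancel_left_of_coprime hg.symm hab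
    rwa [Nat.ModEq, Nat.mod_eq_of_lt (by omega), Nat.mod_eq_of_lt (by omega)] at h
  exact Finset.sum_nbij _ hmaps hinj
    (Finset.surjOn_of_injOn_of_card_le _ hmaps hinj le_rfl) (fun _ _ => rfl)

/-- Voronoi's argument: write g a = r + p⌊g a/p⌋, expand (g a)^(n+1) to first order in p, and sum;
the remainders r permute 1, …, p-1. -/
lemma pow_mul_powSum {g : ℕ} (hg : g.Coprime p) (n : ℕ) :
    (p : ℤ) ^ 2 ∣ ((g : ℤ) ^ (n + 1) - 1) * powSum p (n + 1) - (n + 1) * p * floorSum p g n := by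
  have h1 : ((g : ℤ) ^ (n + 1) - 1) * powSum p (n + 1) - (n + 1) * p * floorSum p g n
      = ∑ a ∈ Finset.Icc 1 (p - 1), (((g * a : ℕ) : ℤ) ^ (n + 1)
        - ((g * a % p : ℕ) : ℤ) ^ (n + 1)
        - (n + 1) * p * (((g * a % p : ℕ) : ℤ) ^ n * ((g * a / p : ℕ) : ℤ))) := by
    rw [Finset.sum_sub_distrib, Finset.sum_sub_distrib, ← Finset.mul_sum,
      sum_mul_mod hg (fun a => (a : ℤ) ^ (n + 1)), floorSum, sub_mul, one_mul, powSum,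
      Finset.mul_sum]
    simp only [Nat.cast_mul, mul_pow]
  rw [h1]
  refine Finset.dvd_sum fun a _ => ?_
  have h2 : ((g * a : ℕ) : ℤ) = ((g * a % p : ℕ) : ℤ) + p * ((g * a / p : ℕ) : ℤ) := by
    exact_mod_cast (Nat.mod_add_div (g * a) p).symm
  obtain ⟨k, hk⟩ := Polynomial.powAddExpansion ((g * a % p : ℕ) : ℤ)
    (p * ((g * a / p : ℕ) : ℤ)) (n + 1)
  rw [h2, hk]
  refine ⟨k * ((g * a / p : ℕ) : ℤ) ^ 2, ?_⟩
  rw [Nat.add_sub_cancel]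
  push_cast
  ring

lemma pow_mul_powSum_of_dvd_choose {g : ℕ} (hg : g.Coprime p) (n : ℕ)
    (hn : p ∣ (n + 2).choose 2) :
    (p : ℤ) ^ 3 ∣ ((g : ℤ) ^ (n + 2) - 1) * powSum p (n + 2)
      - (n + 2) * p * floorSum p g (n + 1) := by
  have h1 : ((g : ℤ) ^ (n + 2) - 1) * powSum p (n + 2) - (n + 2) * p * floorSum p g (n + 1)
      = ∑ a ∈ Finset.Icc 1 (p - 1), (((g * a : ℕ) : ℤ) ^ (n + 2)
        - ((g * a % p : ℕ) : ℤ) ^ (n + 2)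
        - (n + 2) * p * (((g * a % p : ℕ) : ℤ) ^ (n + 1) * ((g * a / p : ℕ) : ℤ))) := by
    rw [Finset.sum_sub_distrib, Finset.sum_sub_distrib, ← Finset.mul_sum,
      sum_mul_mod hg (fun a => (a : ℤ) ^ (n + 2)), floorSum, sub_mul, one_mul, powSum,
      Finset.mul_sum]
    simp only [Nat.cast_mul, mul_pow]
  rw [h1]
  refine Finset.dvd_sum fun a _ => ?_
  have h2 : ((g * a : ℕ) : ℤ) = ((g * a % p : ℕ) : ℤ) + p * ((g * a / p : ℕ) : ℤ) := by
    exact_mod_cast (Nat.mod_add_div (g * a) p).symm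
  obtain ⟨k, hk⟩ := exists_add_pow_cubic ((g * a % p : ℕ) : ℤ)
    (p * ((g * a / p : ℕ) : ℤ)) n
  obtain ⟨c, hc⟩ := hn
  rw [h2, hk, hc]
  refine ⟨c * ((g * a % p : ℕ) : ℤ) ^ n * ((g * a / p : ℕ) : ℤ) ^ 2
    + k * ((g * a / p : ℕ) : ℤ) ^ 3, ?_⟩
  push_cast
  ring

lemma int_pow_add_card_sub_one (r : ℤ) (m : ℕ) :
    (p : ℤ) ∣ r ^ (m + 1 + (p - 1)) - r ^ (m + 1) := by
  have hp := hpf.out.two_le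
  have h : (p : ℤ) ∣ r ^ p - r := by
    rw [← ZMod.intCast_zmod_eq_zero_iff_dvd]
    push_cast
    rw [ZMod.pow_card, sub_self]
  have e : r ^ (m + 1 + (p - 1)) - r ^ (m + 1) = r ^ m * (r ^ p - r) := by
    rw [show m + 1 + (p - 1) = m + p by omega]
    ring
  rw [e]
  exact h.mul_left _

lemma floorSum_add_card_sub_one (g m : ℕ) :
    (p : ℤ) ∣ floorSum p g (m + 1 + (p - 1)) - floorSum p g (m + 1) := by
  rw [floorSum, floorSum, ← Finset.sum_sub_distrib]
  refine Finset.dvd_sum fun a _ => ?_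
  rw [← sub_mul]
  exact (int_pow_add_card_sub_one _ _).mul_right _

lemma exists_coprime_pow_sub_one {n : ℕ} (hn : ¬ (p - 1) ∣ n) :
    ∃ g : ℕ, g.Coprime p ∧ ¬ (p : ℤ) ∣ (g : ℤ) ^ n - 1 := by
  have h := FiniteField.forall_pow_eq_one_iff (ZMod p) n
  rw [ZMod.card] at h
  rw [← h] at hn
  push Not at hn
  obtain ⟨x, hx⟩ := hn
  refine ⟨(x : ZMod p).val, ZMod.val_coe_unit_coprime x, fun hd => hx ?_⟩
  rw [← ZMod.intCast_zmod_eq_zero_iff_dvd] at hd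
  push_cast at hd
  rw [ZMod.natCast_zmod_val, sub_eq_zero] at hd
  exact Units.ext (by simpa using hd)

lemma pow_dvd_of_dvd_mul {u s : ℤ} {k : ℕ} (hu : ¬ (p : ℤ) ∣ u) (h : (p : ℤ) ^ k ∣ u * s) :
    (p : ℤ) ^ k ∣ s :=
  IsCoprime.dvd_of_dvd_mul_left
    (((Nat.prime_iff_prime_int.1 hpf.out).coprime_iff_not_dvd.2 hu).pow_left) h

lemma dvd_powSum {n : ℕ} (hn : ¬ (p - 1) ∣ n + 1) : (p : ℤ) ∣ powSum p (n + 1) := by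
  obtain ⟨g, hg, hgn⟩ := exists_coprime_pow_sub_one hn
  have h := pow_mul_powSum hg n
  have h1 : (p : ℤ) ^ 1 ∣ ((g : ℤ) ^ (n + 1) - 1) * powSum p (n + 1) := by
    obtain ⟨c, hc⟩ := h
    exact ⟨p * c + (n + 1) * floorSum p g n, by linear_combination hc⟩
  simpa using pow_dvd_of_dvd_mul hgn h1

/-- Kummer's congruence for power sums. -/
lemma powSum_kummer {n : ℕ} (h2 : 2 ≤ n) (hn : n ≤ p - 2) :
    (p : ℤ) ^ 2 ∣ n * (powSum p (n + (p - 1)) - powSum p n) + powSum p n := by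
  have hp := hpf.out.two_le
  obtain ⟨m, rfl⟩ : ∃ m, n = m + 1 + 1 := ⟨n - 2, by omega⟩
  have hnd : ¬ (p - 1) ∣ m + 1 + 1 := fun h => by
    have := Nat.le_of_dvd (by omega) h
    omega
  have hnd' : ¬ (p - 1) ∣ (m + 1 + (p - 1)) + 1 := fun h => hnd (by
    rw [show m + 1 + (p - 1) + 1 = m + 1 + 1 + (p - 1) by omega] at h
    exact (Nat.dvd_add_left dvd_rfl).1 h)
  obtain ⟨g, hg, hgn⟩ := exists_coprime_pow_sub_one hnd
  obtain ⟨α, hα⟩ := pow_mul_powSum hg (m + 1 + (p - 1))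
  obtain ⟨β, hβ⟩ := pow_mul_powSum hg (m + 1)
  obtain ⟨γ, hγ⟩ := floorSum_add_card_sub_one (p := p) g m
  obtain ⟨σ, hσ⟩ := dvd_powSum hnd'
  obtain ⟨δ, hδ⟩ := int_dvd_pow_sub_one hg
  refine pow_dvd_of_dvd_mul hgn ?_
  rw [show m + 1 + 1 + (p - 1) = m + 1 + (p - 1) + 1 by omega]
  have hc : ((m + 1 + (p - 1) : ℕ) : ℤ) = m + p := by
    rw [show m + 1 + (p - 1) = m + p by omega]; push_cast; ring
  rw [hc] at hα
  have hG : (g : ℤ) ^ (m + 1 + (p - 1) + 1) = (g : ℤ) ^ (m + 1 + 1) * (1 + p * δ) := by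
    rw [← hδ]
    ring
  rw [hG] at hα
  set G := (g : ℤ) ^ (m + 1 + 1)
  set S' := powSum p (m + 1 + (p - 1) + 1)
  set S := powSum p (m + 1 + 1)
  set V' := floorSum p g (m + 1 + (p - 1))
  set V := floorSum p g (m + 1)
  have hV : V' = V + p * γ := by linear_combination hγ
  rw [hV, hσ] at hα
  push_cast at hβ ⊢
  -- With n = m + 2 and G = g^n, modulo p^2: (G-1) S' ≡ (n-1) p V, because p ∣ S' absorbs the factor
  -- 1 + pδ and V' ≡ V mod p; also (G-1) S ≡ n p V. Eliminating V gives n S' ≡ (n-1) S.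
  refine ⟨(m + 2) * α - (m + 1) * β - (m + 2) * G * δ * σ + (m + 2) * V
    + (m + 2) * (m + p + 1) * γ, ?_⟩
  rw [hσ]
  linear_combination (m + 2 : ℤ) * hα - (m + 1 : ℤ) * hβ

/-- At exponent 2p the Voronoi congruence holds modulo p^3 with main term 2p^2 V_{2p-1}, where V is
the floor sum; p times the one at exponent 2 has main term 2p^2 V_1. These agree because 2p-1 ≡ 1
mod p-1. -/
lemma powSum_two_mul (hp5 : 5 ≤ p) : (p : ℤ) ^ 3 ∣ powSum p (2 * p) - p * powSum p 2 := by
  have hnd : ¬ (p - 1) ∣ 1 + 1 := fun h => by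
    have := Nat.le_of_dvd (by omega) h
    omega
  obtain ⟨g, hg, hgn⟩ := exists_coprime_pow_sub_one hnd
  obtain ⟨m, hm⟩ : ∃ m, 2 * p = m + 2 := ⟨2 * p - 2, by omega⟩
  have hdc : p ∣ (m + 2).choose 2 := by
    rw [Nat.choose_two_right, ← hm, mul_assoc, Nat.mul_div_cancel_left _ (by norm_num)]
    exact dvd_mul_right _ _
  obtain ⟨α, hα⟩ := pow_mul_powSum_of_dvd_choose hg m hdc
  obtain ⟨β, hβ⟩ := pow_mul_powSum hg 1
  obtain ⟨γ, hγ⟩ := floorSum_add_card_sub_one (p := p) g 0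
  obtain ⟨γ', hγ'⟩ := floorSum_add_card_sub_one (p := p) g (p - 1)
  obtain ⟨δ, hδ⟩ : (p : ℤ) ∣ (g : ℤ) ^ (m + 2) - (g : ℤ) ^ 2 := by
    obtain ⟨a, ha⟩ := int_pow_add_card_sub_one (p := p) (g : ℤ) 1
    obtain ⟨b, hb⟩ := int_pow_add_card_sub_one (p := p) (g : ℤ) (1 + (p - 1))
    rw [show 1 + (p - 1) + 1 + (p - 1) = m + 2 by omega,
      show 1 + (p - 1) + 1 = 1 + 1 + (p - 1) by omega] at hb
    exact ⟨a + b, by linear_combination ha + hb⟩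
  rw [show p - 1 + 1 + (p - 1) = m + 1 by omega, show p - 1 + 1 = 0 + 1 + (p - 1) by omega] at hγ'
  have hmc : (m : ℤ) + 2 = 2 * p := by exact_mod_cast hm.symm
  rw [hmc] at hα
  rw [hm]
  set S' := powSum p (m + 2)
  -- This makes replacing g^(2p) by g^2, which is only valid modulo p, harmless modulo p^3.
  have hS : (p : ℤ) ^ 2 ∣ S' := by
    refine pow_dvd_of_dvd_mul (u := (g : ℤ) ^ (m + 2) - 1) (fun h => hgn ?_)
      ⟨2 * floorSum p g (m + 1) + p * α, by linear_combination hα⟩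
    obtain ⟨e, he⟩ := h
    exact ⟨e - δ, by linear_combination he - hδ⟩
  obtain ⟨σ, hσ⟩ := hS
  refine pow_dvd_of_dvd_mul hgn ?_
  push_cast at hβ
  refine ⟨α - β - δ * σ + 2 * (γ + γ'), ?_⟩
  have hV : floorSum p g (m + 1) = floorSum p g (0 + 1) + p * (γ + γ') := by
    linear_combination hγ + hγ'
  rw [hV] at hα
  have hG : (g : ℤ) ^ (m + 2) = (g : ℤ) ^ 2 + p * δ := by linear_combination hδ
  rw [hG] at hα
  simp only [zero_add] at hα
  norm_num at hβ ⊢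
  rw [hσ] at hα ⊢
  linear_combination hα - p * hβ

/-! ### Fermat quotient sums, Parseval and Lerch -/

lemma mul_fermatSum (n : ℕ) :
    (p : ℤ) * fermatSum p n = powSum p (n + (p - 1)) - powSum p n := by
  rw [fermatSum, powSum, powSum, ← Finset.sum_sub_distrib, Finset.mul_sum]
  refine Finset.sum_congr rfl fun a ha => ?_
  rw [pow_add, pow_eq_one_add_fermatInt ha]
  ring

lemma sq_mul_sum_fermatInt_sq :
    (p : ℤ) ^ 2 * ∑ a ∈ Finset.Icc 1 (p - 1), fermatInt p a ^ 2 * (a : ℤ) ^ 2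
      = powSum p (2 * p) - 2 * powSum p (p + 1) + powSum p 2 := by
  have hp := hpf.out.two_le
  rw [powSum, powSum, powSum, Finset.mul_sum, Finset.mul_sum, ← Finset.sum_sub_distrib,
    ← Finset.sum_add_distrib]
  refine Finset.sum_congr rfl fun a ha => ?_
  rw [show 2 * p = (p - 1) + (p - 1) + 2 by omega, show p + 1 = p - 1 + 2 by omega, pow_add,
    pow_add, pow_add, pow_eq_one_add_fermatInt ha]
  ring

lemma sum_pow_mul_pow {a b : ℕ} (ha : a ∈ Finset.Icc 1 (p - 1))
    (hb : b ∈ Finset.Icc 1 (p - 1)) :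
    ∑ n ∈ Finset.Icc 1 (p - 1), (a : ZMod p) ^ n * (b : ZMod p) ^ (p + 1 - n)
      = if a = b then -(a : ZMod p) ^ 2 else 0 := by
  have hp := hpf.out.two_le
  have fermat : ∀ c ∈ Finset.Icc 1 (p - 1), (c : ZMod p) ^ (p - 1) = 1 := fun c hc =>
    ZMod.pow_card_sub_one_eq_one
      (((ZMod.isUnit_iff_coprime c p).2 (coprime_of_mem_Icc hc)).ne_zero)
  split_ifs with hab
  · subst hab
    rw [Finset.sum_congr rfl (g := fun _ => (a : ZMod p) ^ 2)]
    · rw [Finset.sum_const, Nat.card_Icc, nsmul_eq_mul, Nat.add_sub_cancel,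
        Nat.cast_sub (by omega)]
      simp
    · intro n hn
      rw [Finset.mem_Icc] at hn
      rw [← pow_add, show n + (p + 1 - n) = p - 1 + 2 by omega, pow_add, fermat a ha, one_mul]
  · have hne : (a : ZMod p) - b ≠ 0 := by
      rw [sub_ne_zero]
      intro h
      rw [Finset.mem_Icc] at ha hb
      rw [ZMod.natCast_eq_natCast_iff, Nat.ModEq, Nat.mod_eq_of_lt (by omega),
        Nat.mod_eq_of_lt (by omega)] at h
      exact hab h
    -- Off the diagonal the sum is a b^2 times a geometric sum, which a - b multiplies to a^(p-1) -
    -- b^(p-1) = 0.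
    have hg := (Commute.all (a : ZMod p) b).geom_sum₂_mul (p - 1)
    rw [fermat a ha, fermat b hb, sub_self] at hg
    have hz := (mul_eq_zero.1 hg).resolve_right hne
    rw [← Finset.Ico_add_one_right_eq_Icc, Finset.sum_Ico_eq_sum_range, Nat.add_sub_cancel,
      ← mul_zero ((a : ZMod p) * b ^ 2), ← hz, Finset.mul_sum]
    refine Finset.sum_congr rfl fun i hi => ?_
    rw [Finset.mem_range] at hi
    rw [show p + 1 - (1 + i) = 2 + (p - 1 - 1 - i) by omega]
    ring

/-- Parseval's identity for the function `a ↦ a * q_a` on the units modulo `p`. -/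
lemma dvd_sum_fermatSum_mul :
    (p : ℤ) ∣ ∑ n ∈ Finset.Icc 1 (p - 1), fermatSum p n * fermatSum p (p + 1 - n)
      + ∑ a ∈ Finset.Icc 1 (p - 1), fermatInt p a ^ 2 * (a : ℤ) ^ 2 := by
  rw [← ZMod.intCast_zmod_eq_zero_iff_dvd]
  simp only [fermatSum]
  push_cast
  simp only [Finset.sum_mul_sum]
  rw [Finset.sum_comm, ← Finset.sum_add_distrib]
  refine Finset.sum_eq_zero fun a ha => ?_
  rw [Finset.sum_comm]
  have h : ∀ b ∈ Finset.Icc 1 (p - 1), ∑ n ∈ Finset.Icc 1 (p - 1),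
      (fermatInt p a : ZMod p) * (a : ZMod p) ^ n *
        ((fermatInt p b : ZMod p) * (b : ZMod p) ^ (p + 1 - n))
      = if a = b then -((fermatInt p a : ZMod p) ^ 2 * (a : ZMod p) ^ 2) else 0 := by
    intro b hb
    rw [Finset.sum_congr rfl (g := fun n => ((fermatInt p a : ZMod p) * (fermatInt p b : ZMod p))
      * ((a : ZMod p) ^ n * (b : ZMod p) ^ (p + 1 - n))) (fun n _ => by ring),
      ← Finset.mul_sum, sum_pow_mul_pow ha hb]
    split_ifs with hab
    · subst hab; ring
    · ring
  rw [Finset.sum_congr rfl h, Finset.sum_ite_eq, if_pos ha, neg_add_cancel]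

lemma prod_one_add_mul (s : Finset ℕ) (f : ℕ → ℤ) (c : ℤ) :
    c ^ 2 ∣ ∏ a ∈ s, (1 + c * f a) - (1 + c * ∑ a ∈ s, f a) := by
  classical
  induction s using Finset.induction_on with
  | empty => simp
  | insert a s ha ih =>
    obtain ⟨k, hk⟩ := ih
    rw [Finset.prod_insert ha, Finset.sum_insert ha]
    refine ⟨(1 + c * f a) * k + f a * ∑ a ∈ s, f a, ?_⟩
    linear_combination (1 + c * f a) * hk

lemma prod_Icc_eq_factorial (n : ℕ) : ∏ a ∈ Finset.Icc 1 n, a = n.factorial := by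
  induction n with
  | zero => rfl
  | succ n ih => rw [Finset.prod_Icc_succ_top (by omega), ih, Nat.factorial_succ, mul_comm]

/-- Lerch's congruence: the sum of the Fermat quotients is the Wilson quotient modulo `p`. -/
lemma lerch (hp2 : p ≠ 2) :
    (p : ℤ) ^ 2 ∣ p * fermatSum p 0 - ((Nat.factorial (p - 1) : ℤ) + 1) := by
  have hp := hpf.out.two_le
  obtain ⟨w, hw⟩ : (p : ℤ) ∣ (Nat.factorial (p - 1) : ℤ) + 1 := by
    rw [← ZMod.intCast_zmod_eq_zero_iff_dvd]
    push_cast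
    rw [ZMod.wilsons_lemma, neg_add_cancel]
  obtain ⟨k, hk⟩ := prod_one_add_mul (Finset.Icc 1 (p - 1)) (fermatInt p) p
  -- Compare two expansions of ∏ a^(p-1) modulo p^2: 1 + p Σ q_a, and (pw - 1)^(p-1) ≡ 1 - (p-1)pw ≡
  -- 1 + pw.
  have hprod : ∏ a ∈ Finset.Icc 1 (p - 1), (1 + (p : ℤ) * fermatInt p a)
      = (p * w - 1) ^ (p - 1) := by
    rw [← hw, add_sub_cancel_right, ← prod_Icc_eq_factorial]
    push_cast
    rw [← Finset.prod_pow]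
    exact Finset.prod_congr rfl fun a ha => (pow_eq_one_add_fermatInt ha).symm
  obtain ⟨l, hl⟩ := Polynomial.powAddExpansion (-1 : ℤ) (p * w) (p - 1)
  have hodd : Odd p := hpf.out.odd_of_ne_two hp2
  have he : (-1 : ℤ) ^ (p - 1) = 1 := (Nat.Odd.sub_odd hodd odd_one).neg_one_pow
  have ho : (-1 : ℤ) ^ (p - 1 - 1) = -1 := by
    have : (-1 : ℤ) ^ (p - 1 - 1 + 1) = 1 := by rw [show p - 1 - 1 + 1 = p - 1 by omega, he]
    rw [pow_succ] at this
    linarith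
  rw [show (-1 : ℤ) + p * w = p * w - 1 by ring, he, ho, Nat.cast_sub (by omega)] at hl
  rw [hprod, hl] at hk
  rw [hw, fermatSum]
  simp only [pow_zero, mul_one]
  push_cast at hk
  exact ⟨l * w ^ 2 - w - k, by linear_combination -hk⟩

end

/-! ### Rationals integral at p, and Bernoulli numbers -/

lemma not_dvd_of_pos_of_lt {p c : ℕ} (h0 : 0 < c) (hc : c < p) : ¬ p ∣ c := fun h =>
  absurd (Nat.le_of_dvd h0 h) (by omega)

/-- The rational numbers that are `p`-adic integers. -/
noncomputable def pIntegers (p : ℕ) [Fact p.Prime] : Subring ℚ :=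
  (PadicInt.subring p).comap (Rat.castHom ℚ_[p])

section
variable {p : ℕ} [hpf : Fact p.Prime]

lemma mem_pIntegers {x : ℚ} : x ∈ pIntegers p ↔ ‖(x : ℚ_[p])‖ ≤ 1 := Iff.rfl

lemma congrMod_of_mem {x y : ℚ} (h : (x - y) / p ∈ pIntegers p) : CongrMod p x y := by
  have hp : (p : ℚ) ≠ 0 := Nat.cast_ne_zero.2 hpf.out.ne_zero
  refine ⟨⟨_, mem_pIntegers.1 h⟩, ?_⟩
  have : x - y = p * ((x - y) / p) := by field_simp
  have h' := congrArg (Rat.cast : ℚ → ℚ_[p]) this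
  rw [Rat.cast_mul, Rat.cast_natCast] at h'
  exact h'

lemma intCast_div_mem {m : ℤ} {c : ℤ} (h : c ∣ m) : (m : ℚ) / c ∈ pIntegers p := by
  obtain ⟨k, rfl⟩ := h
  by_cases hc : (c : ℚ) = 0
  · rw [hc, div_zero]; exact zero_mem _
  · rw [Int.cast_mul, mul_div_cancel_left₀ _ hc]
    exact intCast_mem _ _

lemma inv_natCast_mem {c : ℕ} (h : ¬ p ∣ c) : (c : ℚ)⁻¹ ∈ pIntegers p := by
  rw [mem_pIntegers]
  have : ‖(c : ℚ_[p])‖ = 1 :=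
    Padic.norm_natCast_eq_one_iff.2 ((Nat.Prime.coprime_iff_not_dvd hpf.out).2 h)
  push_cast
  rw [norm_inv, this, inv_one]

lemma mem_of_natCast_mul_mem {c : ℕ} (h : ¬ p ∣ c) {x : ℚ} (hx : (c : ℚ) * x ∈ pIntegers p) :
    x ∈ pIntegers p := by
  have hc : (c : ℚ) ≠ 0 := by
    rintro h0
    exact h (by rw [Nat.cast_eq_zero.1 h0]; exact dvd_zero p)
  have := mul_mem (inv_natCast_mem h) hx
  rwa [inv_mul_cancel_left₀ hc] at this

/-- Controls the terms p^(m-1)/m of Faulhaber's formula after division by up to p^3. If v ≥ 1 is the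
valuation of m, then m ≥ 5^v ≥ v + 4. -/
lemma pow_div_mem (hp : 5 ≤ p) {s m : ℕ} (hs : s ≤ 4) (hm : 1 ≤ m) (hsm : s ≤ m) :
    (p : ℚ) ^ (m - s) / m ∈ pIntegers p := by
  obtain ⟨v, c, hc, rfl⟩ := Nat.exists_eq_pow_mul_and_not_dvd (n := m) (by omega) p hpf.out.ne_one
  have hv : v ≤ p ^ v * c - s := by
    rcases v with _ | v
    · omega
    · have h1 : v + 5 ≤ 5 ^ (v + 1) := by
        clear hc hm hsm
        induction v with
        | zero => norm_num
        | succ v ih => rw [pow_succ]; omega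
      have h2 : 5 ^ (v + 1) ≤ p ^ (v + 1) := Nat.pow_le_pow_left hp _
      have h3 : p ^ (v + 1) ≤ p ^ (v + 1) * c := Nat.le_mul_of_pos_right _
        (Nat.pos_of_ne_zero (by rintro rfl; simp at hc))
      omega
  have hp0 : (p : ℚ) ≠ 0 := Nat.cast_ne_zero.2 hpf.out.ne_zero
  obtain ⟨k, hk⟩ := Nat.exists_eq_add_of_le hv
  rw [hk]
  have : (p : ℚ) ^ (v + k) / ((p ^ v * c : ℕ) : ℚ) = p ^ k * (c : ℚ)⁻¹ := by
    push_cast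
    rw [pow_add, mul_div_mul_left _ _ (pow_ne_zero _ hp0), div_eq_mul_inv]
  rw [this]
  exact mul_mem (pow_mem (natCast_mem _ _) _) (inv_natCast_mem hc)

/-- Faulhaber's formula for the power sums up to `p - 1`. -/
lemma powSum_eq_sum_bernoulli {n : ℕ} (hn : 1 ≤ n) :
    (powSum p n : ℚ) = p * bernoulli n + ∑ i ∈ Finset.range n,
      (p * bernoulli i) * ((n.choose i : ℕ) * ((p : ℚ) ^ (n + 1 - i - 1) / (n + 1 - i : ℕ))) := by
  have hp := hpf.out.two_le
  have h1 : (powSum p n : ℚ) = ∑ a ∈ Finset.range p, (a : ℚ) ^ n := by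
    rw [powSum, Finset.range_eq_Ico, Finset.sum_eq_sum_Ico_succ_bot (by omega),
      ← Finset.Ico_add_one_right_eq_Icc, Nat.sub_add_cancel (by omega)]
    push_cast
    rw [zero_pow (by omega), zero_add]
  rw [h1, sum_range_pow, Finset.sum_range_succ, add_comm]
  have hn1 : (n : ℚ) + 1 ≠ 0 := by positivity
  congr 1
  · rw [Nat.choose_succ_self_right, Nat.add_sub_cancel_left]
    push_cast
    field_simp
  · refine Finset.sum_congr rfl fun i hi => ?_
    rw [Finset.mem_range] at hi
    have hc : ((n.choose i : ℕ) : ℚ) * (n + 1) = ((n + 1).choose i : ℕ) * (n + 1 - i : ℕ) := by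
      exact_mod_cast Nat.choose_mul_succ_eq n i
    have hi0 : ((n + 1 - i : ℕ) : ℚ) ≠ 0 := Nat.cast_ne_zero.2 (by omega)
    have hpp : (p : ℚ) ^ (n + 1 - i) = p * p ^ (n + 1 - i - 1) := by
      rw [← pow_succ']; congr 1; omega
    rw [hpp]
    field_simp
    linear_combination (-(bernoulli i)) * hc

/-- A weak von Staudt–Clausen theorem, by solving Faulhaber's formula for p B_n. -/
lemma mul_bernoulli_mem (hp : 5 ≤ p) (n : ℕ) : (p : ℚ) * bernoulli n ∈ pIntegers p := by
  induction n using Nat.strong_induction_on with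
  | _ n ih =>
    rcases Nat.eq_zero_or_pos n with rfl | hn
    · rw [bernoulli_zero, mul_one]; exact natCast_mem _ _
    · rw [eq_sub_of_add_eq (powSum_eq_sum_bernoulli (p := p) hn).symm]
      refine sub_mem (intCast_mem _ _) (sum_mem fun i hi => ?_)
      rw [Finset.mem_range] at hi
      exact mul_mem (ih i hi) (mul_mem (natCast_mem _ _)
        (pow_div_mem hp (by omega) (by omega) (by omega)))

lemma bernoulli_mem {n : ℕ} (hn : n + 1 < p) : bernoulli n ∈ pIntegers p := by
  induction n using Nat.strong_induction_on with
  | _ n ih =>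
    rw [bernoulli, bernoulli'_def]
    refine mul_mem (pow_mem (neg_mem (one_mem _)) _) (sub_mem (one_mem _) (sum_mem fun i hi => ?_))
    rw [Finset.mem_range] at hi
    have hi0 : ¬ p ∣ n - i + 1 := not_dvd_of_pos_of_lt (by omega) (by omega)
    have hb : bernoulli' i ∈ pIntegers p := by
      rw [bernoulli'_eq_bernoulli]
      exact mul_mem (pow_mem (neg_mem (one_mem _)) _) (ih i hi (by omega))
    have hinv := inv_natCast_mem hi0
    push_cast [Nat.cast_sub hi.le] at hinv
    rw [div_mul_eq_mul_div, div_eq_mul_inv]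
    exact mul_mem (mul_mem (natCast_mem _ _) hb) hinv

lemma powSum_sub_mul_bernoulli_mem (hp : 5 ≤ p) {n : ℕ} (hn : 1 ≤ n)
    (h : (n : ℚ) * bernoulli (n - 1) ∈ pIntegers p) :
    ((powSum p n : ℚ) - p * bernoulli n) / p ^ 2 ∈ pIntegers p := by
  have hp0 : (p : ℚ) ≠ 0 := Nat.cast_ne_zero.2 hpf.out.ne_zero
  rw [powSum_eq_sum_bernoulli hn, add_sub_cancel_left, Finset.sum_div]
  refine sum_mem fun i hi => ?_
  rw [Finset.mem_range] at hi
  by_cases hin : i + 1 = n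
  · subst hin
    rw [Nat.add_sub_cancel] at h
    have h2 : ¬ p ∣ 2 := not_dvd_of_pos_of_lt (by omega) (by omega)
    have e : i + 1 + 1 - i = 2 := by omega
    rw [e, Nat.choose_succ_self_right]
    convert mul_mem (inv_natCast_mem h2) h using 1
    push_cast
    field_simp
  · have e : (p : ℚ) ^ (n + 1 - i - 1) = p ^ 2 * p ^ (n + 1 - i - 3) := by
      rw [← pow_add]; congr 1; omega
    convert mul_mem (mul_bernoulli_mem hp i) (mul_mem (natCast_mem (pIntegers p) (n.choose i))
        (pow_div_mem hp (s := 3) (m := n + 1 - i) (by omega) (by omega) (by omega))) using 1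
    rw [e]
    field_simp

/-- The B_{n-1} term vanishes by parity, the B_{n-2} term gains its missing p from the binomial
coefficient, and all others carry p^3 outright. -/
lemma powSum_sub_mul_bernoulli_cube_mem (hp : 5 ≤ p) {n : ℕ} (hn : 4 ≤ n) (he : Even n)
    (hc : p ∣ n.choose 2) :
    ((powSum p n : ℚ) - p * bernoulli n) / p ^ 3 ∈ pIntegers p := by
  have hp0 : (p : ℚ) ≠ 0 := Nat.cast_ne_zero.2 hpf.out.ne_zero
  rw [powSum_eq_sum_bernoulli (by omega), add_sub_cancel_left, Finset.sum_div]
  refine sum_mem fun i hi => ?_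
  rw [Finset.mem_range] at hi
  by_cases h1 : i + 1 = n
  · have hodd : Odd i := by
      rw [← h1, Nat.even_add_one, Nat.not_even_iff_odd] at he
      exact he
    rw [bernoulli_eq_zero_of_odd hodd (by omega)]
    simp
  by_cases h2 : i + 2 = n
  · have hch : n.choose i = n.choose 2 := by
      rw [← Nat.choose_symm hi.le]
      congr 1
      omega
    obtain ⟨c, hc⟩ := hc
    have h3 : ¬ p ∣ 3 := not_dvd_of_pos_of_lt (by omega) (by omega)
    have e : n + 1 - i = 3 := by omega
    rw [e, hch, hc]
    convert mul_mem (mul_bernoulli_mem hp i) (mul_mem (natCast_mem (pIntegers p) c)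
      (inv_natCast_mem h3)) using 1
    push_cast
    field_simp
  · have e : (p : ℚ) ^ (n + 1 - i - 1) = p ^ 3 * p ^ (n + 1 - i - 4) := by
      rw [← pow_add]; congr 1; omega
    convert mul_mem (mul_bernoulli_mem hp i) (mul_mem (natCast_mem (pIntegers p) (n.choose i))
        (pow_div_mem hp (s := 4) (m := n + 1 - i) (by omega) (by omega) (by omega))) using 1
    rw [e]
    field_simp

/-! ### Values of the Fermat quotient sums modulo p -/

/-- `Σ q_a a ^ n ≡ - B_n / n` modulo `p`. -/
lemma fermatSum_add_dividedBernoulli_mem (hp : 5 ≤ p) {n : ℕ} (h2 : 2 ≤ n) (hn : n ≤ p - 2) :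
    ((fermatSum p n : ℚ) + dividedBernoulli n) / p ∈ pIntegers p := by
  have hp0 : (p : ℚ) ≠ 0 := Nat.cast_ne_zero.2 hpf.out.ne_zero
  have hn0 : (n : ℚ) ≠ 0 := Nat.cast_ne_zero.2 (by omega)
  have hnd : ¬ p ∣ n := not_dvd_of_pos_of_lt (by omega) (by omega)
  have hk := intCast_div_mem (p := p) (powSum_kummer h2 hn)
  rw [← mul_fermatSum] at hk
  have hf := powSum_sub_mul_bernoulli_mem hp (n := n) (by omega)
    (mul_mem (natCast_mem _ _) (bernoulli_mem (by omega)))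
  refine mem_of_natCast_mul_mem hnd ?_
  convert sub_mem hk hf using 1
  push_cast
  rw [dividedBernoulli]
  field_simp
  ring

lemma two_mul_powSum_one : 2 * powSum p 1 = p * (p - 1) := by
  have hp := hpf.out.two_le
  have h := Finset.sum_range_id_mul_two p
  rw [Finset.range_eq_Ico, Finset.sum_eq_sum_Ico_succ_bot (by omega), zero_add, zero_add] at h
  rw [powSum, ← Finset.Ico_add_one_right_eq_Icc, Nat.sub_add_cancel (by omega), mul_comm]
  simp only [pow_one]
  have h' := congrArg (Nat.cast : ℕ → ℤ) h
  push_cast [Nat.cast_sub (show 1 ≤ p by omega)] at h'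
  exact h'

lemma six_mul_powSum_two : 6 * powSum p 2 = p * (p - 1) * (2 * p - 1) := by
  have hp := hpf.out.two_le
  have h : ∀ n : ℕ, 6 * ∑ a ∈ Finset.Icc 1 n, (a : ℤ) ^ 2 = (n + 1) * n * (2 * n + 1) := by
    intro n
    induction n with
    | zero => simp
    | succ n ih =>
      rw [Finset.sum_Icc_succ_top (by omega), mul_add, ih]
      push_cast
      ring
  rw [powSum, h, Nat.cast_sub (by omega)]
  push_cast
  ring

lemma fermatSum_one_sub_half_mem (hp : 5 ≤ p) :
    ((fermatSum p 1 : ℚ) - 1 / 2) / p ∈ pIntegers p := by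
  have hp0 : (p : ℚ) ≠ 0 := Nat.cast_ne_zero.2 hpf.out.ne_zero
  have h1 := mul_fermatSum (p := p) 1
  have h2 := two_mul_powSum_one (p := p)
  rw [Nat.add_sub_cancel' (by omega)] at h1
  -- B_{p-1} itself need not be integral at p; the factor n = p compensates.
  have hf := powSum_sub_mul_bernoulli_mem hp (n := p) (by omega) (mul_bernoulli_mem hp _)
  rw [bernoulli_eq_zero_of_odd (hpf.out.odd_of_ne_two (by omega)) (by omega), mul_zero,
    sub_zero] at hf
  have hnd : ¬ p ∣ 2 := not_dvd_of_pos_of_lt (by omega) (by omega)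
  have h1' : (p : ℚ) * fermatSum p 1 = powSum p p - powSum p 1 := by exact_mod_cast h1
  have h2' : 2 * (powSum p 1 : ℚ) = p * (p - 1) := by exact_mod_cast h2
  convert sub_mem hf (inv_natCast_mem hnd) using 1
  push_cast
  field_simp
  linear_combination 2 * h1' - h2'

/-- By Fermat, F_{p-1} ≡ F_0, to which Lerch's congruence applies. -/
lemma fermatSum_card_sub_one_sub_wilsonQuot_mem (hp : 5 ≤ p) :
    ((fermatSum p (p - 1) : ℚ) - wilsonQuot p) / p ∈ pIntegers p := by
  have hp0 : (p : ℚ) ≠ 0 := Nat.cast_ne_zero.2 hpf.out.ne_zero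
  have hl := intCast_div_mem (p := p) (lerch (p := p) (by omega))
  have h : (p : ℤ) ∣ fermatSum p (p - 1) - fermatSum p 0 := by
    rw [fermatSum, fermatSum, ← Finset.sum_sub_distrib]
    refine Finset.dvd_sum fun a ha => ?_
    rw [← mul_sub, pow_zero]
    exact (int_dvd_pow_sub_one (coprime_of_mem_Icc ha)).mul_left _
  convert add_mem hl (intCast_div_mem (p := p) h) using 1
  push_cast
  rw [wilsonQuot]
  field_simp
  ring

end

/-! ### The three congruences -/

section
variable {p : ℕ} [hpf : Fact p.Prime]

lemma not_dvd_six (hp : 5 ≤ p) : ¬ p ∣ 6 := by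
  rw [show 6 = 2 * 3 from rfl, hpf.out.dvd_mul, not_or]
  exact ⟨not_dvd_of_pos_of_lt (by omega) (by omega), not_dvd_of_pos_of_lt (by omega) (by omega)⟩

lemma mul_sub_mul_div_mem {x x' y y' : ℚ} (hx : x ∈ pIntegers p) (hy : y ∈ pIntegers p)
    (hxx : (x - x') / p ∈ pIntegers p) (hyy : (y - y') / p ∈ pIntegers p) :
    (x * y - x' * y') / p ∈ pIntegers p := by
  have hp0 : (p : ℚ) ≠ 0 := Nat.cast_ne_zero.2 hpf.out.ne_zero
  have hx' : x' ∈ pIntegers p := by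
    convert sub_mem hx (mul_mem (natCast_mem (pIntegers p) p) hxx) using 1
    field_simp
    ring
  convert add_mem (mul_mem hxx hy) (mul_mem hx' hyy) using 1
  field_simp
  ring

lemma fermatQuot_eq_fermatInt {a : ℕ} (ha : a ∈ Finset.Icc 1 (p - 1)) :
    fermatQuot p a = fermatInt p a := by
  have hp0 : (p : ℚ) ≠ 0 := Nat.cast_ne_zero.2 hpf.out.ne_zero
  have h : (a : ℚ) ^ (p - 1) = 1 + p * fermatInt p a := by
    exact_mod_cast pow_eq_one_add_fermatInt ha
  rw [fermatQuot, h, add_sub_cancel_left, mul_div_cancel_left₀ _ hp0]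

lemma sum_fermatQuot_sq :
    ∑ a ∈ Finset.Icc 1 (p - 1), fermatQuot p a ^ 2 * (a : ℚ) ^ 2
      = ((∑ a ∈ Finset.Icc 1 (p - 1), fermatInt p a ^ 2 * (a : ℤ) ^ 2 : ℤ) : ℚ) := by
  push_cast
  exact Finset.sum_congr rfl fun a ha => by rw [fermatQuot_eq_fermatInt ha]

lemma sum_fermatQuot_sq_eq_powSum :
    ∑ a ∈ Finset.Icc 1 (p - 1), fermatQuot p a ^ 2 * (a : ℚ) ^ 2
      = (powSum p (2 * p) - 2 * powSum p (p + 1) + powSum p 2) / (p : ℚ) ^ 2 := by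
  have hp0 : (p : ℚ) ≠ 0 := Nat.cast_ne_zero.2 hpf.out.ne_zero
  rw [sum_fermatQuot_sq, eq_div_iff (pow_ne_zero _ hp0), mul_comm]
  exact_mod_cast sq_mul_sum_fermatInt_sq (p := p)

lemma powSum_two : (powSum p 2 : ℚ) = p * (p - 1) * (2 * p - 1) / 6 := by
  have h : 6 * (powSum p 2 : ℚ) = p * (p - 1) * (2 * p - 1) := by
    exact_mod_cast six_mul_powSum_two (p := p)
  linarith

lemma powSum_two_mul_sub_mem (hp : 5 ≤ p) :
    ((powSum p (2 * p) : ℚ) - p * bernoulli (2 * p)) / p ^ 3 ∈ pIntegers p := by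
  refine powSum_sub_mul_bernoulli_cube_mem hp (by omega) (even_two_mul p) ?_
  rw [Nat.choose_two_right, mul_assoc, Nat.mul_div_cancel_left _ (by norm_num)]
  exact dvd_mul_right _ _

lemma powSum_add_one_sub_mem (hp : 5 ≤ p) :
    ((powSum p (p + 1) : ℚ) - p * bernoulli (p + 1)) / p ^ 3 ∈ pIntegers p := by
  refine powSum_sub_mul_bernoulli_cube_mem hp (by omega)
    (hpf.out.odd_of_ne_two (by omega)).add_one ?_
  refine (Nat.Prime.dvd_mul hpf.out).1 (?_ : p ∣ (p + 1).choose 2 * 2) |>.resolve_right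
    (not_dvd_of_pos_of_lt (by omega) (by omega))
  rw [Nat.choose_two_right, Nat.div_mul_cancel (Nat.even_mul_pred_self _).two_dvd]
  exact dvd_mul_left _ _

/-- For d = p e the zeroth digit vanishes, so p (d)_1 ≡ d = p e modulo p^2. -/
lemma henselDigit_one_sub_mem {e : ℚ} (he : e ∈ pIntegers p) {d : ℤ_[p]}
    (hd : (d : ℚ_[p]) = ((p * e : ℚ) : ℚ_[p])) :
    ((henselDigit d 1 : ℚ) - e) / p ∈ pIntegers p := by
  have hp0 : (p : ℚ_[p]) ≠ 0 := Nat.cast_ne_zero.2 hpf.out.ne_zero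
  obtain ⟨e', he'⟩ : ∃ e' : ℤ_[p], (e' : ℚ_[p]) = e := ⟨⟨_, mem_pIntegers.1 he⟩, rfl⟩
  have hd' : d = p * e' := by
    apply Subtype.ext
    rw [hd]
    push_cast
    rw [he']
  obtain ⟨z, hz⟩ := Ideal.mem_span_singleton.1 (PadicInt.appr_spec 2 d)
  have hdvd : p ∣ d.appr 2 := by
    have h1 : (p : ℤ_[p]) ^ 1 ∣ ((d.appr 2 : ℤ) : ℤ_[p]) :=
      ⟨e' - p * z, by
        push_cast
        linear_combination hd' - hz⟩
    rw [PadicInt.pow_p_dvd_int_iff, pow_one] at h1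
    exact_mod_cast h1
  have hmul : (p : ℚ_[p]) * henselDigit d 1 = d.appr 2 := by
    rw [henselDigit, pow_one]
    exact_mod_cast congrArg (Nat.cast : ℕ → ℚ_[p]) (Nat.mul_div_cancel' hdvd)
  have hz' : (d : ℚ_[p]) - d.appr 2 = p ^ 2 * z := by
    have := congrArg (Subtype.val : ℤ_[p] → ℚ_[p]) hz
    simpa using this
  rw [mem_pIntegers]
  have key : ((((henselDigit d 1 : ℚ) - e) / p : ℚ) : ℚ_[p]) = ((-z : ℤ_[p]) : ℚ_[p]) := by
    push_cast at hd ⊢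
    rw [div_eq_iff hp0]
    refine mul_left_cancel₀ hp0 ?_
    linear_combination hmul + hd - hz'
  rw [key]
  exact PadicInt.norm_le_one _

lemma dividedBernoulli_two : dividedBernoulli 2 = 1 / 12 := by
  rw [dividedBernoulli, bernoulli_two]
  norm_num

/-- Kummer's congruence: B_{p+1} ≡ S_{p+1}/p = S_2/p + F_2 ≡ 1/6 - 1/12. -/
lemma dividedBernoulli_sub_div_mem (hp : 5 ≤ p) :
    (dividedBernoulli (p + 1) - dividedBernoulli 2) / p ∈ pIntegers p := by
  have hp0 : (p : ℚ) ≠ 0 := Nat.cast_ne_zero.2 hpf.out.ne_zero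
  have hp1 : (p : ℚ) + 1 ≠ 0 := by positivity
  have hF := powSum_add_one_sub_mem hp
  have hE := fermatSum_add_dividedBernoulli_mem hp (n := 2) le_rfl (by omega)
  have h6 := inv_natCast_mem (not_dvd_six hp)
  have h2 := inv_natCast_mem (p := p) (c := 2) (not_dvd_of_pos_of_lt (by omega) (by omega))
  have hU : (p : ℚ) * fermatSum p 2 = powSum p (p + 1) - powSum p 2 := by
    have h := mul_fermatSum (p := p) 2
    rw [show 2 + (p - 1) = p + 1 by omega] at h
    exact_mod_cast h
  have hS := powSum_two (p := p)
  refine mem_of_natCast_mul_mem (c := p + 1)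
    (fun h => hpf.out.one_lt.ne' (Nat.dvd_one.1 ((Nat.dvd_add_right dvd_rfl).1 h))) ?_
  rw [dividedBernoulli_two] at hE ⊢
  have hP := natCast_mem (pIntegers p) p
  have hmem := sub_mem (add_mem hE (mul_mem (sub_mem (mul_mem (natCast_mem (pIntegers p) 2) hP)
    (natCast_mem (pIntegers p) 3)) h6)) (add_mem (mul_mem hP hF) (mul_mem h2 h6))
  convert hmem using 1
  rw [dividedBernoulli]
  push_cast
  field_simp
  linear_combination (-144) * hU + 144 * hS

theorem congrMod_henselDigit (hp : 5 ≤ p) {d : ℤ_[p]}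
    (hd : (d : ℚ_[p]) = ((dividedBernoulli (p + 1) - dividedBernoulli 2 : ℚ) : ℚ_[p])) :
    CongrMod p (∑ a ∈ Finset.Icc 1 (p - 1), fermatQuot p a ^ 2 * (a : ℚ) ^ 2)
      (-2 * (henselDigit d 1 : ℚ) - 1 / 2) := by
  have hp0 : (p : ℚ) ≠ 0 := Nat.cast_ne_zero.2 hpf.out.ne_zero
  have hp1 : (p : ℚ) + 1 ≠ 0 := by positivity
  have he := dividedBernoulli_sub_div_mem hp
  have hh := henselDigit_one_sub_mem he (d := d) (by rw [hd, mul_div_cancel₀ _ hp0])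
  have hG := intCast_div_mem (p := p) (powSum_two_mul hp)
  have hF := powSum_add_one_sub_mem hp
  have h6 := inv_natCast_mem (not_dvd_six hp)
  have hP := natCast_mem (pIntegers p) p
  have h2 := natCast_mem (pIntegers p) 2
  have hS := powSum_two (p := p)
  apply congrMod_of_mem
  rw [sum_fermatQuot_sq_eq_powSum]
  -- With e the divided Bernoulli difference over p, B_{p+1} = (p+1)(1/12 + p e). The main terms
  -- (1+p) S_2/p^2 - 2 B_{p+1}/p then reduce to -1/2 - 2e modulo p.
  have hmem := add_mem (add_mem (sub_mem hG (mul_mem h2 hF)) (mul_mem h2 (sub_mem hh he)))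
    (mul_mem (sub_mem (mul_mem h2 hP) (one_mem _)) h6)
  convert hmem using 1
  rw [dividedBernoulli_two, dividedBernoulli]
  push_cast
  field_simp
  linear_combination 144 * (1 + (p : ℚ)) ^ 2 * hS

theorem congrMod_bernoulli (hp : 5 ≤ p) :
    CongrMod p (∑ a ∈ Finset.Icc 1 (p - 1), fermatQuot p a ^ 2 * (a : ℚ) ^ 2)
      ((6 * p * bernoulli (2 * p) - 12 * p * bernoulli (p + 1)
        + p * (p - 1) * (2 * p - 1)) / (6 * (p : ℚ) ^ 2)) := by
  have hp0 : (p : ℚ) ≠ 0 := Nat.cast_ne_zero.2 hpf.out.ne_zero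
  apply congrMod_of_mem
  rw [sum_fermatQuot_sq_eq_powSum, powSum_two]
  convert sub_mem (powSum_two_mul_sub_mem hp)
    (mul_mem (natCast_mem (pIntegers p) 2) (powSum_add_one_sub_mem hp)) using 1
  push_cast
  field_simp
  ring

/-- The extra indices 3 and p-2 are odd, so their Bernoulli numbers vanish. -/
lemma sum_dividedBernoulli_eq_truncConv (hp : 5 ≤ p) :
    ∑ n ∈ Finset.Icc 3 (p - 2), dividedBernoulli n * dividedBernoulli (p + 1 - n)
      = truncConv 4 (p - 3) := by
  have hodd := hpf.out.odd_of_ne_two (by omega)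
  rw [truncConv, show 4 + (p - 3) = p + 1 by omega]
  refine (Finset.sum_subset (Finset.Icc_subset_Icc (by omega) (by omega)) fun n hn hn' => ?_).symm
  rw [Finset.mem_Icc] at hn hn'
  have hb : bernoulli n = 0 := by
    refine bernoulli_eq_zero_of_odd ?_ (by omega)
    rw [Nat.odd_iff] at hodd ⊢
    omega
  rw [dividedBernoulli, hb, zero_div, zero_mul]

theorem congrMod_truncConv (hp : 5 ≤ p) :
    CongrMod p (∑ a ∈ Finset.Icc 1 (p - 1), fermatQuot p a ^ 2 * (a : ℚ) ^ 2)
      (1 / 6 * wilsonQuot p - 1 / 4 - truncConv 4 (p - 3)) := by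
  have hp0 : (p : ℚ) ≠ 0 := Nat.cast_ne_zero.2 hpf.out.ne_zero
  have hU : ∀ n, (fermatSum p n : ℚ) ∈ pIntegers p := fun n => intCast_mem _ _
  have hB : ∀ n, 2 ≤ n → n ≤ p - 2 →
      ((fermatSum p n : ℚ) - (-dividedBernoulli n)) / p ∈ pIntegers p := fun n h2 hn => by
    rw [sub_neg_eq_add]
    exact fermatSum_add_dividedBernoulli_mem hp h2 hn
  have h1 := fermatSum_one_sub_half_mem hp
  have hw := fermatSum_card_sub_one_sub_wilsonQuot_mem hp
  -- The partner of n = 1 is F_p, just outside the summation range.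
  have hpp : ((fermatSum p p : ℚ) - 1 / 2) / p ∈ pIntegers p := by
    have h : (p : ℤ) ∣ fermatSum p p - fermatSum p 1 := by
      rw [fermatSum, fermatSum, ← Finset.sum_sub_distrib]
      refine Finset.dvd_sum fun a _ => ?_
      rw [← mul_sub]
      have := int_pow_add_card_sub_one (p := p) (a : ℤ) 0
      rw [show 0 + 1 + (p - 1) = p by omega] at this
      exact this.mul_left _
    convert add_mem h1 (intCast_div_mem (p := p) h) using 1
    push_cast
    field_simp
    ring
  have hmid : (∑ n ∈ Finset.Icc 3 (p - 2), (fermatSum p n : ℚ) * fermatSum p (p + 1 - n)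
      - truncConv 4 (p - 3)) / p ∈ pIntegers p := by
    rw [← sum_dividedBernoulli_eq_truncConv hp, ← Finset.sum_sub_distrib, Finset.sum_div]
    refine sum_mem fun n hn => ?_
    rw [Finset.mem_Icc] at hn
    rw [← neg_mul_neg (dividedBernoulli n)]
    exact mul_sub_mul_div_mem (hU _) (hU _) (hB n (by omega) (by omega))
      (hB (p + 1 - n) (by omega) (by omega))
  have hend := mul_sub_mul_div_mem (hU _) (hU _) h1 hpp
  have hw2 := mul_sub_mul_div_mem (hU _) (hU _) hw (hB 2 le_rfl (by omega))
  rw [dividedBernoulli_two] at hw2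
  -- The terms n = 2 and n = p-1 coincide, hence the factor 2.
  have hsplit : ∑ n ∈ Finset.Icc 1 (p - 1), (fermatSum p n : ℚ) * fermatSum p (p + 1 - n)
      = fermatSum p 1 * fermatSum p p + 2 * (fermatSum p (p - 1) * fermatSum p 2)
        + ∑ n ∈ Finset.Icc 3 (p - 2), (fermatSum p n : ℚ) * fermatSum p (p + 1 - n) := by
    rw [← Finset.Ico_add_one_right_eq_Icc, ← Finset.Ico_add_one_right_eq_Icc,
      Finset.sum_eq_sum_Ico_succ_bot (by omega), Finset.sum_eq_sum_Ico_succ_bot (by omega),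
      Finset.sum_Ico_succ_top (by omega), show p - 2 + 1 = p - 1 by omega,
      show p + 1 - 1 = p by omega, show p + 1 - (p - 1) = 2 by omega,
      show p + 1 - (1 + 1) = p - 1 by omega]
    ring
  have hpar := intCast_div_mem (p := p) (dvd_sum_fermatSum_mul (p := p))
  rw [Int.cast_add, ← sum_fermatQuot_sq] at hpar
  push_cast at hpar
  rw [hsplit] at hpar
  apply congrMod_of_mem
  convert sub_mem (sub_mem (sub_mem hpar hend) (mul_mem (natCast_mem (pIntegers p) 2) hw2)) hmid
    using 1
  push_cast
  field_simp
  ring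

end

theorem theorem4 (p : ℕ) [Fact p.Prime] (hp : 5 ≤ p) :
    CongrMod p (∑ a ∈ Finset.Icc 1 (p - 1), fermatQuot p a ^ 2 * (a : ℚ) ^ 2)
        (1 / 6 * wilsonQuot p - 1 / 4 - truncConv 4 (p - 3)) ∧
    (∃ d : ℤ_[p],
      (d : ℚ_[p]) = ((dividedBernoulli (p + 1) - dividedBernoulli 2 : ℚ) : ℚ_[p]) ∧
      CongrMod p (∑ a ∈ Finset.Icc 1 (p - 1), fermatQuot p a ^ 2 * (a : ℚ) ^ 2)
        (-2 * (henselDigit d 1 : ℚ) - 1 / 2)) ∧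
    CongrMod p (∑ a ∈ Finset.Icc 1 (p - 1), fermatQuot p a ^ 2 * (a : ℚ) ^ 2)
        ((6 * p * bernoulli (2 * p) - 12 * p * bernoulli (p + 1)
          + p * (p - 1) * (2 * p - 1)) / (6 * (p : ℚ) ^ 2)) := by
  have hp0 : (p : ℚ) ≠ 0 := by positivity
  have hd : dividedBernoulli (p + 1) - dividedBernoulli 2 ∈ pIntegers p := by
    have h := mul_mem (natCast_mem (pIntegers p) p) (dividedBernoulli_sub_div_mem hp)
    rwa [mul_div_cancel₀ _ hp0] at h
  exact ⟨congrMod_truncConv hp, ⟨⟨_, mem_pIntegers.1 hd⟩, rfl, congrMod_henselDigit hp rfl⟩,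
    congrMod_bernoulli hp⟩
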